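/- Let $C(n,k)=\{0,1,\dots,n-1\}^k$. For a chess piece $X$ the distance $\delta_n^k(X)(V_1,V_2)\in\{0,1,2,\dots,+\infty\}$ is the least number of moves of $X$ inside $C(n,k)$ that lead from $V_1$ to $V_2$ ($+\infty$ if there is none); the eccentricity of a vertex is its largest distance to a vertex of $C(n,k)$; the diameter $d_n^k(X)$ and the radius $r_n^k(X)$ are the largest and the smallest eccentricity. The $k$-queen $\tilde Q$ moves in one step either by changing exactly one coordinate by any nonzero amount, or by changing exactly two coordinates by $\pm c$ each (signs chosen independently) for some $c\ge 1$. The $k$-knight $\tilde N$ moves by changing one coordinate by $\pm2$ and another one by $\pm1$. All moves must stay inside $C(n,k)$. The $k$-pawn distance is $\delta_n^k(\tilde P)(V_1,V_1)=0$ and, for $V_1\neq V_2$ in $C(n,k)$, $$\delta_n^k(\tilde P)(V_1,V_2)=n-2+M_n+\min\{\delta_n^k(\tilde Q)(V_1,V_2),\ \delta_n^k(\tilde N)(V_1,V_2)\},$$ where $M_n=\max\{d_n^2(\tilde Q),d_n^2(\tilde N)\}$ if $n\ge4$ and $M_n=d_n^2(\tilde Q)$ if $n\le3$; the eccentricities,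 the diameter $d_n^k(\tilde P)$ and the radius $r_n^k(\tilde P)$ are formed from this distance as above. Then: 1. For $n\ge5$ one has $d_n^2(\tilde N)=\lceil 2n/3\rceil$, and for all $k\ge2$ and all $V_1\ne V_2$ in $C(n,k)$, $\delta_n^k(\tilde P)(V_1,V_2)=n-2+\lceil 2n/3\rceil+\min\{\delta_n^k(\tilde Q)(V_1,V_2),\delta_n^k(\tilde N)(V_1,V_2)\}$. 2. For every integer $n\ge1$, $d_n^3(\tilde P)=n-2+d_n^2(\tilde N)+3$ if and only if $n\ge5$; in particular $d_n^3(\tilde P)=n-2+\lceil 2n/3\rceil+3$ for every $n\ge5$. 3. $r_n^3(\tilde P)=n-2+d_n^2(\tilde N)+3$ for every $n\ge8$, and $r_n^3(\tilde P)<n-2+d_n^2(\tilde N)+3$ for every $n$ with $3<n<8$. -/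

import Mathlib

open scoped ENat

namespace LatticeChess

/-- The board `C(n,k) = {0, …, n-1}^k`. -/
abbrev Board (n k : ℕ) : Type := Fin k → Fin n

/-- The displacement `c_j = y_j - x_j` in the `j`-th coordinate. -/
def disp {n k : ℕ} (x y : Board n k) (j : Fin k) : ℤ := ((y j : ℕ) : ℤ) - ((x j : ℕ) : ℤ)

/-- A move of the `k`-rook: exactly one coordinate changes, by any amount. -/
def RookMove {n k : ℕ} (x y : Board n k) : Prop :=
  ∃ i, disp x y i ≠ 0 ∧ ∀ j, j ≠ i → disp x y j = 0

/-- A move of the `k`-bishop: exactly two coordinates change, by the same amount in absolute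
value. -/
def BishopMove {n k : ℕ} (x y : Board n k) : Prop :=
  (∃ c : ℤ, ∀ j, disp x y j = -c ∨ disp x y j = 0 ∨ disp x y j = c) ∧
    (Finset.univ.filter fun j => disp x y j ≠ 0).card = 2

/-- A move of the `k`-queen: a move of the `k`-rook or of the `k`-bishop. -/
def QueenMove {n k : ℕ} (x y : Board n k) : Prop := RookMove x y ∨ BishopMove x y

/-- A move of the `k`-knight: one coordinate changes by `±2` and another one by `±1`. -/
def KnightMove {n k : ℕ} (x y : Board n k) : Prop :=
  (∑ j, |disp x y j| = 3) ∧ (∀ j, |disp x y j| = 0 ∨ |disp x y j| = 1 ∨ |disp x y j| = 2) ∧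
    ∃! j, |disp x y j| = 1

theorem disp_swap {n k : ℕ} (x y : Board n k) (j : Fin k) : disp y x j = -disp x y j := by
  unfold disp; ring

theorem disp_self {n k : ℕ} (x : Board n k) (j : Fin k) : disp x x j = 0 := by
  unfold disp; ring

theorem QueenMove.swap {n k : ℕ} {x y : Board n k} (h : QueenMove x y) : QueenMove y x := by
  rcases h with ⟨i, hi, h⟩ | ⟨⟨c, hc⟩, h⟩
  · refine Or.inl ⟨i, ?_, fun j hj => ?_⟩
    · rw [disp_swap]; exact neg_ne_zero.mpr hi
    · rw [disp_swap, h j hj, neg_zero]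
  · refine Or.inr ⟨⟨c, fun j => ?_⟩, ?_⟩
    · rw [disp_swap]; have := hc j; omega
    · simpa only [disp_swap x y, neg_ne_zero] using h

theorem KnightMove.swap {n k : ℕ} {x y : Board n k} (h : KnightMove x y) : KnightMove y x := by
  unfold KnightMove at *
  simpa only [disp_swap x y, abs_neg] using h

/-- The graph of the `k`-queen on `C(n,k)`. -/
def queenGraph (n k : ℕ) : SimpleGraph (Board n k) where
  Adj := QueenMove
  symm := ⟨fun _ _ h => h.swap⟩
  loopless := ⟨fun x h => by
    rcases h with ⟨i, hi, _⟩ | ⟨_, h⟩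
    · exact hi (disp_self x i)
    · simp [disp_self] at h⟩

/-- The graph of the `k`-knight on `C(n,k)`. -/
def knightGraph (n k : ℕ) : SimpleGraph (Board n k) where
  Adj := KnightMove
  symm := ⟨fun _ _ h => h.swap⟩
  loopless := ⟨fun x h => by
    have := h.1
    simp [disp_self] at this⟩

/-- The number of moves granted to the `k`-pawn for coming back home after its promotion:
`max {d_n^2(Q), d_n^2(N)}` for `n ≥ 4`, and `d_n^2(Q)` on the small boards `n ≤ 3`. -/
noncomputable def returnTime (n : ℕ) : ℕ∞ :=
  if 4 ≤ n then max (queenGraph n 2).ediam (knightGraph n 2).ediam else (queenGraph n 2).ediam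

open Classical in
/-- The `k`-pawn distance on `C(n,k)`. Unreachable vertices are at queen or knight distance `⊤`.
Distinct vertices exist only for `n ≥ 2`, so the subtraction `n - 2` is never truncated here. -/
noncomputable def pawnDist {n k : ℕ} (x y : Board n k) : ℕ∞ :=
  if x = y then 0
  else ((n - 2 : ℕ) : ℕ∞) + returnTime n +
    min ((queenGraph n k).edist x y) ((knightGraph n k).edist x y)

/-- The eccentricity of a vertex for the `k`-pawn distance. -/
noncomputable def pawnEccent {n k : ℕ} (x : Board n k) : ℕ∞ := ⨆ y, pawnDist x y

/-- The diameter of `C(n,k)` for the `k`-pawn distance: the largest eccentricity. -/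
noncomputable def pawnDiam (n k : ℕ) : ℕ∞ := ⨆ x : Board n k, pawnEccent x

/-- The radius of `C(n,k)` for the `k`-pawn distance: the smallest eccentricity. -/
noncomputable def pawnRadius (n k : ℕ) : ℕ∞ := ⨅ x : Board n k, pawnEccent x

end LatticeChess

namespace LatticeChess

/-! ### The knight on the square board -/

/-! For the square knight, two extra moves pay for three extra rows and columns, matching
`⌈2(n+3)/3⌉ = ⌈2n/3⌉ + 2`. The induction `knightReach_add_three` starts from sides 5, 6 (computed)
and 7 (reduced to 6). The lower bound holds because a move changes the coordinate sum by at most 3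
and flips its parity (`knight_walk_bound`).

In dimension 3 the queen needs at most three moves, so everything depends on which displacements she
can make in two. Boundary aside, these are the ones with a zero entry, with two entries of equal
absolute value, or with one absolute value the sum of the other two. Entries of size at most 3
always qualify, since `3 = 1 + 2` (`exists_queenShape_split`), while `(±4, ±2, ±1)` does not
(`three_le_queen_edist`). The knight also needs three moves for the latter, as `4 + 2 + 1 > 6`. Such
a displacement fits on the board from some vertex when `n ≥ 5`, and from every vertex when `n ≥ 8`;
these are the thresholds for diameter and radius. -/

theorem knightMove_two_iff {n : ℕ} (x y : Board n 2) :
    KnightMove x y ↔ (|disp x y 0| = 1 ∧ |disp x y 1| = 2) ∨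
      (|disp x y 0| = 2 ∧ |disp x y 1| = 1) := by
  unfold KnightMove
  simp only [Fin.sum_univ_two, Fin.forall_fin_two]
  constructor
  · rintro ⟨h, ⟨h0, h1⟩, -⟩
    omega
  · rintro (⟨h0, h1⟩ | ⟨h0, h1⟩)
    · refine ⟨by omega, by omega, 0, h0, fun j hj => ?_⟩
      fin_cases j
      · rfl
      · simp only [Fin.mk_one] at hj; omega
    · refine ⟨by omega, by omega, 1, h1, fun j hj => ?_⟩
      fin_cases j
      · simp only [Fin.zero_eta] at hj; omega
      · rfl

/-- The point `(c, d)` can be reached from `(a, b)` by at most `m` knight moves inside the square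
`[p, p + n) × [q, q + n)`. -/
inductive KnightReach (p q n c d : ℤ) : ℕ → ℤ → ℤ → Prop
  | refl (m : ℕ) : KnightReach p q n c d m c d
  | step {m : ℕ} {a b : ℤ} (e f : ℤ) (he : p ≤ e ∧ e < p + n) (hf : q ≤ f ∧ f < q + n)
      (hm : (|e - a| = 1 ∧ |f - b| = 2) ∨ (|e - a| = 2 ∧ |f - b| = 1))
      (h : KnightReach p q n c d m e f) : KnightReach p q n c d (m + 1) a b

namespace KnightReach

theorem mono {p q n p' q' n' c d a b : ℤ} {m m' : ℕ} (h : KnightReach p q n c d m a b)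
    (hm : m ≤ m') (hp : p' ≤ p) (hq : q' ≤ q) (hpn : p + n ≤ p' + n') (hqn : q + n ≤ q' + n') :
    KnightReach p' q' n' c d m' a b := by
  induction h generalizing m' with
  | refl => exact .refl _
  | step e f he hf hmv _ ih =>
    obtain ⟨m', rfl⟩ : ∃ l, m' = l + 1 := ⟨m' - 1, by omega⟩
    exact .step e f (by omega) (by omega) hmv (ih (by omega))

theorem translate {p q n c d a b : ℤ} {m : ℕ} (h : KnightReach p q n c d m a b) (s t : ℤ) :
    KnightReach (p + s) (q + t) n (c + s) (d + t) m (a + s) (b + t) := by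
  induction h with
  | refl => exact .refl _
  | step e f he hf hmv _ ih =>
    exact .step (e + s) (f + t) (by omega) (by omega) (by simpa using hmv) ih

theorem edist_le {n : ℕ} {y : Board n 2} {m : ℕ} {a b : ℤ}
    (h : KnightReach 0 0 n ((y 0 : ℕ) : ℤ) ((y 1 : ℕ) : ℤ) m a b) :
    ∀ x : Board n 2, ((x 0 : ℕ) : ℤ) = a → ((x 1 : ℕ) : ℤ) = b →
      (knightGraph n 2).edist x y ≤ m := by
  induction h with
  | refl m =>
    intro x h0 h1
    have : x = y := by
      funext j
      fin_cases j
      · exact Fin.ext (by simpa using h0)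
      · exact Fin.ext (by simpa using h1)
    simp [this]
  | @step m a b e f he hf hmv _ ih =>
    intro x h0 h1
    let z : Board n 2 := ![⟨e.toNat, by omega⟩, ⟨f.toNat, by omega⟩]
    have z0 : ((z 0 : ℕ) : ℤ) = e := by simp [z]; omega
    have z1 : ((z 1 : ℕ) : ℤ) = f := by simp [z]; omega
    have hadj : (knightGraph n 2).Adj x z := by
      refine (knightMove_two_iff x z).2 ?_
      simpa only [disp, z0, z1, h0, h1] using hmv
    calc (knightGraph n 2).edist x y
        ≤ (knightGraph n 2).edist x z + (knightGraph n 2).edist z y :=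
          SimpleGraph.edist_triangle
      _ ≤ 1 + m := add_le_add (SimpleGraph.edist_eq_one_iff_adj.2 hadj).le (ih z z0 z1)
      _ = ((m + 1 : ℕ) : ℕ∞) := by push_cast; ring

end KnightReach

/-! ### Small boards, encoded as bit masks with eight bits per row -/

/-- The squares of the `n × n` board. -/
def boardMask (n : ℕ) : ℕ :=
  (List.range n).foldl (fun s a => s ||| ((2 ^ n - 1) <<< (8 * a))) 0

/-- One step of breadth-first search for the knight. -/
def knightStep (B S : ℕ) : ℕ :=
  (S ||| (S <<< 6) ||| (S <<< 10) ||| (S <<< 15) ||| (S <<< 17) |||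
    (S >>> 6) ||| (S >>> 10) ||| (S >>> 15) ||| (S >>> 17)) &&& B

/-- The squares within `m` knight moves of a square with index `i`. -/
def knightBall (B i : ℕ) : ℕ → ℕ
  | 0 => 2 ^ i
  | m + 1 => knightStep B (knightBall B i m)

theorem boardMask_spec : ∀ n < 7, 3 < n → ∀ i < 64, (boardMask n).testBit i = true →
    i / 8 < n ∧ i % 8 < n := by
  decide +kernel

/-- The square `(a, b)` has index `8a + b`, so the eight knight moves shift indices by `±(8 ± 2)`
and `±(16 ± 1)`. Only soundness of the search is needed. -/
theorem testBit_knightStep {B S i : ℕ} (h : (knightStep B S).testBit i = true) :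
    B.testBit i = true ∧ (S.testBit i = true ∨ ∃ j, S.testBit j = true ∧
      (i = j + 6 ∨ i = j + 10 ∨ i = j + 15 ∨ i = j + 17 ∨
        j = i + 6 ∨ j = i + 10 ∨ j = i + 15 ∨ j = i + 17)) := by
  simp only [knightStep, Nat.testBit_and, Nat.testBit_or, Nat.testBit_shiftLeft,
    Nat.testBit_shiftRight, Bool.and_eq_true, Bool.or_eq_true, decide_eq_true_eq] at h
  refine ⟨h.2, ?_⟩
  obtain ⟨(((((((( h | h) | h) | h) | h) | h) | h) | h) | h), -⟩ := h
  · exact .inl h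
  · exact .inr ⟨i - 6, h.2, by omega⟩
  · exact .inr ⟨i - 10, h.2, by omega⟩
  · exact .inr ⟨i - 15, h.2, by omega⟩
  · exact .inr ⟨i - 17, h.2, by omega⟩
  · exact .inr ⟨_, h, by omega⟩
  · exact .inr ⟨_, h, by omega⟩
  · exact .inr ⟨_, h, by omega⟩
  · exact .inr ⟨_, h, by omega⟩

/-- With columns 0 to 5 only, an index difference of 6, 10, 15 or 17 always comes from a genuine
knight move. On side 7 this fails: columns 0 and 6 of one row differ by 6. -/
theorem KnightReach.of_testBit {n : ℕ} (h3 : 3 < n) (h7 : n < 7) {i : ℕ}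
    (hi : i < 64) (hin : i / 8 < n ∧ i % 8 < n) (m : ℕ) : ∀ j < 64, j / 8 < n ∧ j % 8 < n →
    (knightBall (boardMask n) i m).testBit j = true →
    KnightReach 0 0 n ((i / 8 : ℕ) : ℤ) ((i % 8 : ℕ) : ℤ) m ((j / 8 : ℕ) : ℤ) ((j % 8 : ℕ) : ℤ) := by
  induction m with
  | zero =>
    intro j _ _ h
    simp only [knightBall, Nat.testBit_two_pow, decide_eq_true_eq] at h
    subst h
    exact .refl _
  | succ m ih =>
    intro j hj hjn h
    obtain ⟨-, h | ⟨l, hl, hlj⟩⟩ := testBit_knightStep h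
    · exact (ih j hj hjn h).mono (Nat.le_succ m) le_rfl le_rfl le_rfl le_rfl
    · have hln : l < 64 ∧ l / 8 < n ∧ l % 8 < n := by
        -- The initial ball is not cut down by the mask, so its one square is on the board by
        -- hypothesis.
        cases m with
        | zero =>
          simp only [knightBall, Nat.testBit_two_pow, decide_eq_true_eq] at hl
          subst hl
          exact ⟨hi, hin⟩
        | succ m =>
          have hB := (testBit_knightStep hl).1
          have hl64 : l < 64 := by
            by_contra hcon
            have hlt : boardMask n < 2 ^ 64 := by
              interval_cases n <;> decide +kernel
            rw [Nat.testBit_lt_two_pow (hlt.trans_le (Nat.pow_le_pow_right (by norm_num)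
              (by omega)))] at hB
            exact absurd hB (by simp)
          exact ⟨hl64, boardMask_spec n h7 h3 l hl64 hB⟩
      refine .step ((l / 8 : ℕ) : ℤ) ((l % 8 : ℕ) : ℤ) (by omega) (by omega) ?_
        (ih l hln.1 hln.2 hl)
      have := hln.2
      simp only [abs_eq (show (0 : ℤ) ≤ 1 by norm_num), abs_eq (show (0 : ℤ) ≤ 2 by norm_num)]
      omega

theorem knightReach_small {n m : ℕ} (h3 : 3 < n) (h7 : n < 7)
    (h : ∀ a < n, ∀ b < n, ∀ c < n, ∀ d < n,
      (knightBall (boardMask n) (8 * c + d) m).testBit (8 * a + b) = true)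
    {a b c d : ℤ} (ha : 0 ≤ a ∧ a < n) (hb : 0 ≤ b ∧ b < n) (hc : 0 ≤ c ∧ c < n)
    (hd : 0 ≤ d ∧ d < n) : KnightReach 0 0 n c d m a b := by
  lift a to ℕ using ha.1
  lift b to ℕ using hb.1
  lift c to ℕ using hc.1
  lift d to ℕ using hd.1
  have := KnightReach.of_testBit h3 h7 (i := 8 * c + d) (by omega) (by omega) m (8 * a + b)
    (by omega) (by omega) (h a (by omega) b (by omega) c (by omega) d (by omega))
  rwa [show (8 * a + b) / 8 = a by omega, show (8 * a + b) % 8 = b by omega,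
    show (8 * c + d) / 8 = c by omega, show (8 * c + d) % 8 = d by omega] at this

theorem knightReach_four {a b c d : ℤ} (ha : 0 ≤ a ∧ a < 4) (hb : 0 ≤ b ∧ b < 4)
    (hc : 0 ≤ c ∧ c < 4) (hd : 0 ≤ d ∧ d < 4) : KnightReach 0 0 4 c d 5 a b :=
  knightReach_small (n := 4) (by norm_num) (by norm_num) (by decide +kernel) ha hb hc hd

theorem knightReach_five {a b c d : ℤ} (ha : 0 ≤ a ∧ a < 5) (hb : 0 ≤ b ∧ b < 5)
    (hc : 0 ≤ c ∧ c < 5) (hd : 0 ≤ d ∧ d < 5) : KnightReach 0 0 5 c d 4 a b :=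
  knightReach_small (n := 5) (by norm_num) (by norm_num) (by decide +kernel) ha hb hc hd

theorem knightReach_six {a b c d : ℤ} (ha : 0 ≤ a ∧ a < 6) (hb : 0 ≤ b ∧ b < 6)
    (hc : 0 ≤ c ∧ c < 6) (hd : 0 ≤ d ∧ d < 6) : KnightReach 0 0 6 c d 4 a b :=
  knightReach_small (n := 6) (by norm_num) (by norm_num) (by decide +kernel) ha hb hc hd

/-! ### The diameter of the knight graph of the square board -/

/-- Two points whose coordinates lie in `[0, n)` and differ by less than `l` lie in a common
interval of length `l` inside `[0, n)`. -/
theorem exists_interval {n l a c : ℤ} (hl : l ≤ n) (ha : 0 ≤ a ∧ a < n) (hc : 0 ≤ c ∧ c < n)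
    (h : |c - a| < l) :
    ∃ p, 0 ≤ p ∧ p + l ≤ n ∧ (0 ≤ a - p ∧ a - p < l) ∧ (0 ≤ c - p ∧ c - p < l) := by
  rw [abs_lt] at h
  -- The interval starts at the smaller point, pushed back if it would overrun the board.
  refine ⟨min (min a c) (n - l), ?_⟩
  omega

theorem KnightReach.of_subboard {n l m : ℕ} (hl : l ≤ n)
    (H : ∀ a b c d : ℤ, 0 ≤ a ∧ a < l → 0 ≤ b ∧ b < l → 0 ≤ c ∧ c < l → 0 ≤ d ∧ d < l →
      KnightReach 0 0 l c d m a b)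
    {a b c d : ℤ} (ha : 0 ≤ a ∧ a < n) (hb : 0 ≤ b ∧ b < n)
    (hc : 0 ≤ c ∧ c < n) (hd : 0 ≤ d ∧ d < n) (h1 : |c - a| < l) (h2 : |d - b| < l) :
    KnightReach 0 0 n c d m a b := by
  obtain ⟨p, hp0, hpn, hpa, hpc⟩ := exists_interval (by exact_mod_cast hl) ha hc h1
  obtain ⟨q, hq0, hqn, hqb, hqd⟩ := exists_interval (by exact_mod_cast hl) hb hd h2
  have := (H _ _ _ _ hpa hqb hpc hqd).translate p q
  simp only [sub_add_cancel, zero_add] at this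
  exact this.mono le_rfl hp0 hq0 (by omega) (by omega)

theorem KnightReach.swap {p q n c d a b : ℤ} {m : ℕ} (h : KnightReach p q n c d m a b) :
    KnightReach q p n d c m b a := by
  induction h with
  | refl => exact .refl _
  | step e f he hf hmv _ ih => exact .step f e hf he (by tauto) ih

/-- Points whose coordinates differ by less than 6 share a `6 × 6` subboard, where four moves
suffice. Otherwise one move first brings them into such a subboard. -/
theorem knightReach_seven {a b c d : ℤ} (ha : 0 ≤ a ∧ a < 7) (hb : 0 ≤ b ∧ b < 7)
    (hc : 0 ≤ c ∧ c < 7) (hd : 0 ≤ d ∧ d < 7) : KnightReach 0 0 7 c d 5 a b := by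
  have sub : ∀ {a b c d : ℤ}, 0 ≤ a ∧ a < 7 → 0 ≤ b ∧ b < 7 → 0 ≤ c ∧ c < 7 → 0 ≤ d ∧ d < 7 →
      |c - a| < 6 → |d - b| < 6 → KnightReach 0 0 7 c d 4 a b := fun ha hb hc hd h1 h2 =>
    KnightReach.of_subboard (n := 7) (l := 6) (by norm_num)
      (fun _ _ _ _ h h' k k' => knightReach_six h h' k k') ha hb hc hd h1 h2
  have main : ∀ {a b c d : ℤ}, 0 ≤ a ∧ a < 7 → 0 ≤ b ∧ b < 7 → 0 ≤ c ∧ c < 7 → 0 ≤ d ∧ d < 7 →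
      6 ≤ |c - a| → KnightReach 0 0 7 c d 5 a b := by
    intro a b c d ha hb hc hd h
    obtain ⟨s, hs, hs'⟩ : ∃ s : ℤ, (s = 2 ∨ s = -2) ∧ |c - (a + s)| < 6 ∧ 0 ≤ a + s ∧ a + s < 7 := by
      rcases le_abs.1 h with h | h
      · exact ⟨2, .inl rfl, abs_lt.2 (by omega), by omega⟩
      · exact ⟨-2, .inr rfl, abs_lt.2 (by omega), by omega⟩
    obtain ⟨t, ht, ht'⟩ : ∃ t : ℤ, (t = 1 ∨ t = -1) ∧ |d - (b + t)| < 6 ∧ 0 ≤ b + t ∧ b + t < 7 := by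
      by_cases hbd : d < b ∨ b = 6
      · exact ⟨-1, .inr rfl, abs_lt.2 (by omega), by omega⟩
      · exact ⟨1, .inl rfl, abs_lt.2 (by omega), by omega⟩
    refine .step (a + s) (b + t) (by omega) (by omega) (.inr ?_)
      (sub hs'.2 ht'.2 hc hd hs'.1 ht'.1)
    rcases hs with rfl | rfl <;> rcases ht with rfl | rfl <;> simp
  by_cases h1 : |c - a| < 6
  · by_cases h2 : |d - b| < 6
    · exact (sub ha hb hc hd h1 h2).mono (by norm_num) le_rfl le_rfl le_rfl le_rfl
    · exact (main hb ha hd hc (not_lt.1 h2)).swap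
  · exact main ha hb hc hd (not_lt.1 h1)

/-- If both differences are below `n`, a common `n × n` subboard suffices. Otherwise two moves bring
the points into one: `(2, 1) + (1, 2) = (3, 3)` towards the target if the other difference is at
least 3, and `(2, ±1) + (2, ∓1) = (4, 0)` if it is smaller. The shift by 4 does not overshoot
because the large difference is at least `n ≥ 5`. -/
theorem knightReach_add_three {n m : ℕ} (hn : 5 ≤ n)
    (H : ∀ a b c d : ℤ, 0 ≤ a ∧ a < n → 0 ≤ b ∧ b < n → 0 ≤ c ∧ c < n → 0 ≤ d ∧ d < n →
      KnightReach 0 0 n c d m a b)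
    {a b c d : ℤ} (ha : 0 ≤ a ∧ a < (n + 3 : ℕ)) (hb : 0 ≤ b ∧ b < (n + 3 : ℕ))
    (hc : 0 ≤ c ∧ c < (n + 3 : ℕ)) (hd : 0 ≤ d ∧ d < (n + 3 : ℕ)) :
    KnightReach 0 0 (n + 3 : ℕ) c d (m + 2) a b := by
  have sub : ∀ {a b c d : ℤ}, 0 ≤ a ∧ a < (n + 3 : ℕ) → 0 ≤ b ∧ b < (n + 3 : ℕ) →
      0 ≤ c ∧ c < (n + 3 : ℕ) → 0 ≤ d ∧ d < (n + 3 : ℕ) →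
      |c - a| < n → |d - b| < n → KnightReach 0 0 (n + 3 : ℕ) c d m a b :=
    fun ha hb hc hd h1 h2 => KnightReach.of_subboard (by omega) H ha hb hc hd h1 h2
  have main : ∀ {a b c d : ℤ}, 0 ≤ a ∧ a < (n + 3 : ℕ) → 0 ≤ b ∧ b < (n + 3 : ℕ) →
      0 ≤ c ∧ c < (n + 3 : ℕ) → 0 ≤ d ∧ d < (n + 3 : ℕ) →
      (n : ℤ) ≤ |c - a| → KnightReach 0 0 (n + 3 : ℕ) c d (m + 2) a b := by
    intro a b c d ha hb hc hd h
    obtain ⟨s, hs, hs'⟩ : ∃ s : ℤ, (s = 1 ∨ s = -1) ∧ (n : ℤ) ≤ s * (c - a) := by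
      rcases le_abs.1 h with h | h
      · exact ⟨1, .inl rfl, by omega⟩
      · exact ⟨-1, .inr rfl, by omega⟩
    by_cases h3 : |d - b| < 3
    · obtain ⟨t, ht, ht'⟩ : ∃ t : ℤ, (t = 1 ∨ t = -1) ∧ 0 ≤ b + t ∧ b + t < (n + 3 : ℕ) := by
        by_cases hb0 : b = 0
        · exact ⟨1, .inl rfl, by omega⟩
        · exact ⟨-1, .inr rfl, by omega⟩
      refine .step (a + 2 * s) (b + t) ?_ (by omega) (.inr ?_)
        (.step (a + 4 * s) b ?_ (by omega) (.inr ?_) (sub ?_ hb hc hd ?_ ?_))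
      · rcases hs with rfl | rfl <;> omega
      · rcases hs with rfl | rfl <;> rcases ht with rfl | rfl <;> simp
      · rcases hs with rfl | rfl <;> omega
      · rcases hs with rfl | rfl <;> rcases ht with rfl | rfl <;> ring_nf <;> simp
      · rcases hs with rfl | rfl <;> omega
      · rw [abs_lt]; rcases hs with rfl | rfl <;> omega
      · omega
    · obtain ⟨t, ht, ht'⟩ : ∃ t : ℤ, (t = 1 ∨ t = -1) ∧ 3 ≤ t * (d - b) := by
        rcases le_abs.1 (not_lt.1 h3) with h | h
        · exact ⟨1, .inl rfl, by omega⟩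
        · exact ⟨-1, .inr rfl, by omega⟩
      refine .step (a + 2 * s) (b + t) ?_ ?_ (.inr ?_)
        (.step (a + 3 * s) (b + 3 * t) ?_ ?_ (.inl ?_) (sub ?_ ?_ hc hd ?_ ?_))
      · rcases hs with rfl | rfl <;> omega
      · rcases ht with rfl | rfl <;> omega
      · rcases hs with rfl | rfl <;> rcases ht with rfl | rfl <;> simp
      · rcases hs with rfl | rfl <;> omega
      · rcases ht with rfl | rfl <;> omega
      · rcases hs with rfl | rfl <;> rcases ht with rfl | rfl <;> ring_nf <;> simp
      · rcases hs with rfl | rfl <;> omega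
      · rcases ht with rfl | rfl <;> omega
      · rw [abs_lt]; rcases hs with rfl | rfl <;> omega
      · rw [abs_lt]; rcases ht with rfl | rfl <;> omega
  by_cases h1 : |c - a| < n
  · by_cases h2 : |d - b| < n
    · exact (sub ha hb hc hd h1 h2).mono (by omega) le_rfl le_rfl le_rfl le_rfl
    · exact (main hb ha hd hc (not_lt.1 h2)).swap
  · exact main ha hb hc hd (not_lt.1 h1)

theorem knightReach_of_five_le (n : ℕ) (hn : 5 ≤ n) : ∀ a b c d : ℤ, 0 ≤ a ∧ a < n →
    0 ≤ b ∧ b < n → 0 ≤ c ∧ c < n → 0 ≤ d ∧ d < n →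
    KnightReach 0 0 n c d ((2 * n + 2) / 3) a b := by
  induction n using Nat.strong_induction_on with
  | _ n ih =>
    intro a b c d ha hb hc hd
    obtain rfl | rfl | rfl | h : n = 5 ∨ n = 6 ∨ n = 7 ∨ 8 ≤ n := by omega
    · exact knightReach_five ha hb hc hd
    · exact knightReach_six ha hb hc hd
    · exact knightReach_seven ha hb hc hd
    · obtain ⟨l, rfl⟩ : ∃ l, n = l + 3 := ⟨n - 3, by omega⟩
      have := knightReach_add_three (by omega) (ih l (by omega) (by omega)) ha hb hc hd
      rwa [show (2 * (l + 3) + 2) / 3 = (2 * l + 2) / 3 + 2 by omega]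

/-- A knight walk of length `m` changes the coordinates by at most `3 * m` in total, and by an
amount of the parity of `m`. -/
theorem knight_walk_bound {n k : ℕ} {x y : Board n k} (w : (knightGraph n k).Walk x y) :
    ∑ j, |disp x y j| ≤ 3 * w.length ∧ (2 : ℤ) ∣ ∑ j, |disp x y j| - w.length := by
  induction w with
  | nil => simp [disp_self]
  | @cons x z y hadj w ih =>
    have h3 : ∑ j, |disp x z j| = 3 := (show KnightMove x z from hadj).1
    have htri : ∑ j, |disp x y j| ≤ ∑ j, |disp x z j| + ∑ j, |disp z y j| := by
      rw [← Finset.sum_add_distrib]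
      refine Finset.sum_le_sum fun j _ => ?_
      rw [show disp x y j = disp x z j + disp z y j by unfold disp; ring]
      exact abs_add_le _ _
    have hpar : (2 : ℤ) ∣ ∑ j, |disp x z j| + ∑ j, |disp z y j| - ∑ j, |disp x y j| := by
      rw [← Finset.sum_add_distrib, ← Finset.sum_sub_distrib]
      refine Finset.dvd_sum fun j _ => ?_
      rw [show disp x y j = disp x z j + disp z y j by unfold disp; ring]
      rcases abs_choice (disp x z j) with h | h <;> rcases abs_choice (disp z y j) with h' | h' <;>
        rcases abs_choice (disp x z j + disp z y j) with h'' | h'' <;> rw [h, h', h''] <;> omega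
    rw [SimpleGraph.Walk.length_cons]
    push_cast
    omega

theorem le_knight_edist {n k m : ℕ} {x y : Board n k}
    (h : ∀ l : ℕ, ∑ j, |disp x y j| ≤ 3 * l → (2 : ℤ) ∣ ∑ j, |disp x y j| - l → m ≤ l) :
    (m : ℕ∞) ≤ (knightGraph n k).edist x y := by
  by_cases htop : (knightGraph n k).edist x y = ⊤
  · simp [htop]
  · obtain ⟨w, hw⟩ := SimpleGraph.exists_walk_of_edist_ne_top htop
    rw [← hw]
    exact_mod_cast h _ (knight_walk_bound w).1 (knight_walk_bound w).2

theorem knight_ediam_two (n : ℕ) (hn : 5 ≤ n) :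
    (knightGraph n 2).ediam = ((2 * n + 2) / 3 : ℕ) := by
  apply le_antisymm
  · refine SimpleGraph.ediam_le_of_edist_le fun x y => ?_
    exact (knightReach_of_five_le n hn _ _ _ _ (by omega) (by omega) (by omega) (by omega)).edist_le
      x rfl rfl
  -- For `n = 3q + 1` opposite corners have coordinate sum `6q`, which only forces `2q` moves. A
  -- neighbour of the corner has sum `6q - 1`, and oddness forces `2q + 1`.
  · by_cases h : n % 3 = 1
    · refine le_trans (le_knight_edist (x := ![⟨0, by omega⟩, ⟨0, by omega⟩])
        (y := ![⟨n - 1, by omega⟩, ⟨n - 2, by omega⟩]) fun l h1 h2 => ?_)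
        SimpleGraph.edist_le_ediam
      simp [disp, Fin.sum_univ_two] at h1 h2
      omega
    · refine le_trans (le_knight_edist (x := ![⟨0, by omega⟩, ⟨0, by omega⟩])
        (y := ![⟨n - 1, by omega⟩, ⟨n - 1, by omega⟩]) fun l h1 h2 => ?_)
        SimpleGraph.edist_le_ediam
      simp [disp, Fin.sum_univ_two] at h1 h2
      omega

theorem natCeil_two_mul_div_three (n : ℕ) : ⌈(2 * n : ℚ) / 3⌉₊ = (2 * n + 2) / 3 := by
  refine le_antisymm (Nat.ceil_le.2 ?_) (Nat.le_of_lt_succ ?_)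
  · rw [div_le_iff₀ (by norm_num)]
    exact_mod_cast (by omega : 2 * n ≤ (2 * n + 2) / 3 * 3)
  · have h : (2 * n : ℚ) ≤ ⌈(2 * n : ℚ) / 3⌉₊ * 3 := (div_le_iff₀ (by norm_num)).1 (Nat.le_ceil _)
    have h' : 2 * n ≤ ⌈(2 * n : ℚ) / 3⌉₊ * 3 := by exact_mod_cast h
    omega

theorem knight_ediam_four_ne_top : (knightGraph 4 2).ediam ≠ ⊤ := by
  refine ne_top_of_le_ne_top (ENat.natCast_ne_top 5) (SimpleGraph.ediam_le_of_edist_le fun x y => ?_)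
  have hlt : ∀ i : Fin 4, 0 ≤ ((i : ℕ) : ℤ) ∧ ((i : ℕ) : ℤ) < 4 := fun i => by
    exact ⟨Int.natCast_nonneg _, by exact_mod_cast i.2⟩
  exact (knightReach_four (hlt _) (hlt _) (hlt _) (hlt _)).edist_le x rfl rfl

theorem two_le_knight_ediam (n : ℕ) (hn : 4 ≤ n) : 2 ≤ (knightGraph n 2).ediam := by
  refine le_trans (le_knight_edist (m := 2) (x := ![⟨0, by omega⟩, ⟨0, by omega⟩])
    (y := ![⟨3, by omega⟩, ⟨3, by omega⟩]) fun l h1 _ => ?_) SimpleGraph.edist_le_ediam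
  simp [disp, Fin.sum_univ_two] at h1
  omega

/-- From `(1, 1)` no coordinate can change by 2, so this square is isolated. -/
theorem knight_ediam_eq_top (n : ℕ) (h2 : 2 ≤ n) (h3 : n ≤ 3) : (knightGraph n 2).ediam = ⊤ := by
  by_contra htop
  obtain ⟨w, -⟩ := SimpleGraph.exists_walk_of_edist_ne_top
    (ne_top_of_le_ne_top htop (SimpleGraph.edist_le_ediam (u := ![⟨1, by omega⟩, ⟨1, by omega⟩])
      (v := ![⟨0, by omega⟩, ⟨0, by omega⟩])))
  have hnil : ¬ w.Nil := fun h => by simpa using congrFun h.eq 0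
  have h := (knightMove_two_iff _ _).1 (w.adj_snd hnil)
  have h0 := (w.snd 0).2
  have h1 := (w.snd 1).2
  simp only [disp, Matrix.cons_val_zero, Matrix.cons_val_one] at h
  rcases h with h | h
  · exact absurd h.2 (by rw [abs_eq (by norm_num)]; omega)
  · exact absurd h.1 (by rw [abs_eq (by norm_num)]; omega)

/-! ### The queen -/

theorem rookMove_update {n k : ℕ} (x : Board n k) (i : Fin k) (a : Fin n) :
    (queenGraph n k).edist x (Function.update x i a) ≤ 1 := by
  rw [SimpleGraph.edist_le_one_iff_adj_or_eq]
  by_cases h : a = x i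
  · right; rw [h, Function.update_eq_self]
  · left
    refine Or.inl ⟨i, ?_, fun j hj => ?_⟩
    · simp only [disp, Function.update_self]
      have : (a : ℕ) ≠ x i := fun h' => h (Fin.ext h')
      omega
    · simp [disp, Function.update_of_ne hj]

/-- Changing the coordinates one after another, the queen needs at most `k` moves. -/
theorem queen_edist_le {n k : ℕ} (x y : Board n k) : (queenGraph n k).edist x y ≤ k := by
  have key : ∀ s : Finset (Fin k),
      (queenGraph n k).edist x (fun j => if j ∈ s then y j else x j) ≤ s.card := by
    intro s
    induction s using Finset.induction_on with
    | empty => simp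
    | @insert i s hi ih =>
      have hup : (fun j => if j ∈ insert i s then y j else x j) =
          Function.update (fun j => if j ∈ s then y j else x j) i (y i) := by
        funext j
        by_cases hj : j = i
        · subst hj; simp
        · simp [hj]
      rw [hup, Finset.card_insert_of_notMem hi]
      push_cast
      exact SimpleGraph.edist_triangle.trans (add_le_add ih (rookMove_update _ _ _))
  simpa using key Finset.univ

/-- The displacements of the moves of the `3`-queen, including the trivial one. -/
def QueenShape (a b c : ℤ) : Prop :=
  (a = 0 ∧ (b = 0 ∨ c = 0 ∨ b = c ∨ b = -c)) ∨ (b = 0 ∧ (a = 0 ∨ c = 0 ∨ a = c ∨ a = -c)) ∨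
    (c = 0 ∧ (a = 0 ∨ b = 0 ∨ a = b ∨ a = -b))

/-- This turns queen moves into linear conditions on displacements, which `omega` can settle. -/
theorem queen_edist_le_one_iff {n : ℕ} (x y : Board n 3) :
    (queenGraph n 3).edist x y ≤ 1 ↔ QueenShape (disp x y 0) (disp x y 1) (disp x y 2) := by
  rw [SimpleGraph.edist_le_one_iff_adj_or_eq]
  constructor
  · rintro (h | rfl)
    · rcases h with ⟨i, -, h⟩ | ⟨⟨c, hc⟩, h⟩
      · unfold QueenShape
        have h0 := h 0; have h1 := h 1; have h2 := h 2
        fin_cases i <;> simp at h0 h1 h2 <;> simp [h0, h1, h2]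
      · have h0 := hc 0; have h1 := hc 1; have h2 := hc 2
        have hz : disp x y 0 = 0 ∨ disp x y 1 = 0 ∨ disp x y 2 = 0 := by
          by_contra! hcon
          have : (Finset.univ.filter fun j => disp x y j ≠ 0) = Finset.univ := by
            rw [Finset.filter_eq_self]
            intro j _
            fin_cases j
            exacts [hcon.1, hcon.2.1, hcon.2.2]
          rw [this] at h
          simp at h
        unfold QueenShape
        omega
    · simp [QueenShape, disp_self]
  · intro h
    by_cases hxy : x = y
    · exact .inr hxy
    left
    have hne : disp x y 0 ≠ 0 ∨ disp x y 1 ≠ 0 ∨ disp x y 2 ≠ 0 := by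
      by_contra! hcon
      apply hxy
      unfold disp at hcon
      funext j
      apply Fin.ext
      fin_cases j
      · show (x 0 : ℕ) = y 0; omega
      · show (x 1 : ℕ) = y 1; omega
      · show (x 2 : ℕ) = y 2; omega
    have rook : ∀ i, disp x y i ≠ 0 → (∀ j, j ≠ i → disp x y j = 0) → QueenMove x y :=
      fun i h h' => .inl ⟨i, h, h'⟩
    have bishop : ∀ i j l : Fin 3, i ≠ j → i ≠ l → j ≠ l → disp x y i ≠ 0 → disp x y l = 0 →
        (disp x y i = disp x y j ∨ disp x y i = -disp x y j) → QueenMove x y := by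
      intro i j l hij hil hjl hi hl h
      have hall : ∀ m, m = i ∨ m = j ∨ m = l := by omega
      refine .inr ⟨⟨disp x y i, fun m => ?_⟩, ?_⟩
      · rcases hall m with rfl | rfl | rfl <;> omega
      · rw [Finset.card_eq_two]
        refine ⟨i, j, hij, ?_⟩
        ext m
        simp only [Finset.mem_filter, Finset.mem_univ, true_and, Finset.mem_insert,
          Finset.mem_singleton]
        rcases hall m with rfl | rfl | rfl
        · simp [hi]
        · simp only [or_true, iff_true]; omega
        · simp [hl, hil.symm, hjl.symm]
    have r0 := rook 0; have r1 := rook 1; have r2 := rook 2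
    simp only [Fin.forall_fin_succ, Fin.isValue] at r0 r1 r2
    simp at r0 r1 r2
    have b0 := bishop 1 2 0 (by decide) (by decide) (by decide)
    have b1 := bishop 0 2 1 (by decide) (by decide) (by decide)
    have b2 := bishop 0 1 2 (by decide) (by decide) (by decide)
    unfold QueenShape at h
    show QueenMove x y
    clear rook bishop hxy
    generalize disp x y 0 = a at *
    generalize disp x y 1 = b at *
    generalize disp x y 2 = c at *
    by_cases ha : a = 0 <;> by_cases hb : b = 0 <;> by_cases hc : c = 0 <;>
      simp_all

theorem exists_of_queen_edist_le_two {n k : ℕ} {x y : Board n k}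
    (h : (queenGraph n k).edist x y ≤ 2) :
    ∃ z, (queenGraph n k).edist x z ≤ 1 ∧ (queenGraph n k).edist z y ≤ 1 := by
  obtain ⟨w, hw⟩ := SimpleGraph.exists_walk_of_edist_ne_top
    (ne_top_of_le_ne_top (by simp) h)
  rw [← hw] at h
  have hlen : w.length ≤ 2 := by exact_mod_cast h
  cases w with
  | nil => exact ⟨x, by simp, by simp⟩
  | cons hadj w =>
    refine ⟨_, (SimpleGraph.edist_eq_one_iff_adj.2 hadj).le, w.edist_le.trans ?_⟩
    rw [SimpleGraph.Walk.length_cons] at hlen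
    exact_mod_cast (by omega : w.length ≤ 1)

/-- Two queen moves with no zero in their total are a bishop and a rook move on complementary
coordinates, giving two equal absolute values, or two bishop moves sharing one coordinate, making
one entry a signed sum of the others up to sign. Neither fits 4, 2, 1. -/
theorem three_le_queen_edist {n : ℕ} {x y : Board n 3} (h0 : |disp x y 0| = 4)
    (h1 : |disp x y 1| = 2) (h2 : |disp x y 2| = 1) : 3 ≤ (queenGraph n 3).edist x y := by
  by_contra hlt
  have hle : (queenGraph n 3).edist x y ≤ 2 := by
    rw [not_le] at hlt
    exact Order.le_of_lt_add_one (by simpa [two_add_one_eq_three] using hlt)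
  obtain ⟨z, hxz, hzy⟩ := exists_of_queen_edist_le_two hle
  rw [queen_edist_le_one_iff] at hxz hzy
  have hsum : ∀ j, disp x y j = disp x z j + disp z y j := fun j => by unfold disp; ring
  rw [hsum, abs_eq (by norm_num)] at h0 h1 h2
  unfold QueenShape at hxz hzy
  omega

/-- Small displacements split into two queen moves inside the bounding box. -/
theorem exists_queenShape_split {n x0 x1 x2 y0 y1 y2 : ℤ} (hx0 : 0 ≤ x0 ∧ x0 < n)
    (hx1 : 0 ≤ x1 ∧ x1 < n) (hx2 : 0 ≤ x2 ∧ x2 < n) (hy0 : 0 ≤ y0 ∧ y0 < n)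
    (hy1 : 0 ≤ y1 ∧ y1 < n) (hy2 : 0 ≤ y2 ∧ y2 < n) (h0 : |y0 - x0| ≤ 3) (h1 : |y1 - x1| ≤ 3)
    (h2 : |y2 - x2| ≤ 3) :
    ∃ z0 z1 z2, (0 ≤ z0 ∧ z0 < n) ∧ (0 ≤ z1 ∧ z1 < n) ∧ (0 ≤ z2 ∧ z2 < n) ∧
      QueenShape (z0 - x0) (z1 - x1) (z2 - x2) ∧ QueenShape (y0 - z0) (y1 - z1) (y2 - z2) := by
  obtain ⟨a, rfl⟩ : ∃ a, y0 = x0 + a := ⟨y0 - x0, by ring⟩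
  obtain ⟨b, rfl⟩ : ∃ b, y1 = x1 + b := ⟨y1 - x1, by ring⟩
  obtain ⟨c, rfl⟩ : ∃ c, y2 = x2 + c := ⟨y2 - x2, by ring⟩
  simp only [add_sub_cancel_left, abs_le] at h0 h1 h2
  unfold QueenShape
  by_cases ha : a = 0 ∨ b = 0 ∨ c = 0 ∨ a = b ∨ a = -b
  · by_cases hb : b = 0
    · exact ⟨x0 + a, x1 + b, x2, by omega, by omega, by omega, by omega, by omega⟩
    · by_cases ha0 : a = 0
      · exact ⟨x0, x1 + b, x2, by omega, by omega, by omega, by omega, by omega⟩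
      · by_cases hc : c = 0
        · exact ⟨x0 + a, x1, x2, by omega, by omega, by omega, by omega, by omega⟩
        · exact ⟨x0 + a, x1 + b, x2, by omega, by omega, by omega, by omega, by omega⟩
  · by_cases hac : a = c ∨ a = -c
    · exact ⟨x0 + a, x1, x2 + c, by omega, by omega, by omega, by omega, by omega⟩
    · by_cases hbc : b = c ∨ b = -c
      · exact ⟨x0, x1 + b, x2 + c, by omega, by omega, by omega, by omega, by omega⟩
      -- The absolute values are now distinct, nonzero and at most 3, hence 1, 2, 3 in some order.
      · obtain ⟨s, t, hs, ht, h⟩ : ∃ s t : ℤ, (s = 1 ∨ s = -1) ∧ (t = 1 ∨ t = -1) ∧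
            a = s * b + t * c := by
          obtain h | h | h | h : a = b + c ∨ a = b - c ∨ a = -b + c ∨ a = -b - c := by omega
          · exact ⟨1, 1, by omega⟩
          · exact ⟨1, -1, by omega⟩
          · exact ⟨-1, 1, by omega⟩
          · exact ⟨-1, -1, by omega⟩
        -- The two bishop moves share the coordinate of largest absolute value. Their contributions
        -- to it have the same sign, so the midpoint stays in the bounding box.
        obtain hm | hm | hm : ((0 ≤ s * b ∧ 0 ≤ t * c) ∨ (s * b ≤ 0 ∧ t * c ≤ 0)) ∨
            ((0 ≤ a ∧ t * c ≤ 0) ∨ (a ≤ 0 ∧ 0 ≤ t * c)) ∨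
            ((0 ≤ a ∧ s * b ≤ 0) ∨ (a ≤ 0 ∧ 0 ≤ s * b)) := by omega
        · refine ⟨x0 + s * b, x1 + b, x2, ?_⟩
          rcases hs with rfl | rfl <;> rcases ht with rfl | rfl <;> omega
        · refine ⟨x0 + a, x1 + s * a, x2, ?_⟩
          rcases hs with rfl | rfl <;> rcases ht with rfl | rfl <;> omega
        · refine ⟨x0 + a, x1, x2 + t * a, ?_⟩
          rcases hs with rfl | rfl <;> rcases ht with rfl | rfl <;> omega

theorem queen_edist_le_two_of_small {n : ℕ} {x y : Board n 3} (h : ∀ j, |disp x y j| ≤ 3) :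
    (queenGraph n 3).edist x y ≤ 2 := by
  have hlt : ∀ (v : Board n 3) (j : Fin 3), 0 ≤ ((v j : ℕ) : ℤ) ∧ ((v j : ℕ) : ℤ) < n :=
    fun v j => ⟨Int.natCast_nonneg _, by exact_mod_cast (v j).2⟩
  obtain ⟨z0, z1, z2, hz0, hz1, hz2, hxz, hzy⟩ := exists_queenShape_split (hlt x 0) (hlt x 1)
    (hlt x 2) (hlt y 0) (hlt y 1) (hlt y 2) (h 0) (h 1) (h 2)
  lift z0 to ℕ using hz0.1
  lift z1 to ℕ using hz1.1
  lift z2 to ℕ using hz2.1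
  let z : Board n 3 := ![⟨z0, by omega⟩, ⟨z1, by omega⟩, ⟨z2, by omega⟩]
  have h1 : (queenGraph n 3).edist x z ≤ 1 := (queen_edist_le_one_iff x z).2 hxz
  have h2 : (queenGraph n 3).edist z y ≤ 1 := (queen_edist_le_one_iff z y).2 hzy
  calc _ ≤ _ := SimpleGraph.edist_triangle (v := z)
    _ ≤ 1 + 1 := add_le_add h1 h2
    _ = 2 := by norm_num

/-! ### The pawn -/

/-- The queen's diameter on the square is at most 2, and the knight's is at least 2 once `n ≥ 4`. -/
theorem returnTime_eq {n : ℕ} (hn : 4 ≤ n) : returnTime n = (knightGraph n 2).ediam := by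
  rw [returnTime, if_pos hn, max_eq_right]
  exact (SimpleGraph.ediam_le_of_edist_le fun x y => by
    simpa using queen_edist_le x y).trans (two_le_knight_ediam n hn)

theorem pawnDist_le {n k : ℕ} {x y : Board n k} {m : ℕ∞}
    (h : (queenGraph n k).edist x y ≤ m) :
    pawnDist x y ≤ ((n - 2 : ℕ) : ℕ∞) + returnTime n + m := by
  unfold pawnDist
  split_ifs
  · exact zero_le
  · exact add_le_add_right ((min_le_left _ _).trans h) _

theorem pawnDist_eq {n : ℕ} {x y : Board n 3} (h0 : |disp x y 0| = 4)
    (h1 : |disp x y 1| = 2) (h2 : |disp x y 2| = 1) :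
    pawnDist x y = ((n - 2 : ℕ) : ℕ∞) + returnTime n + 3 := by
  refine le_antisymm (pawnDist_le (queen_edist_le x y)) ?_
  have hne : x ≠ y := fun h => by simp [h, disp_self] at h0
  rw [pawnDist, if_neg hne]
  refine add_le_add_right (le_min (three_le_queen_edist h0 h1 h2) ?_) _
  refine le_knight_edist (m := 3) fun l hl _ => ?_
  rw [Fin.sum_univ_three, h0, h1, h2] at hl
  omega

theorem knight_ediam_ne_top {n : ℕ} (hn : 4 ≤ n) : (knightGraph n 2).ediam ≠ ⊤ := by
  rcases hn.eq_or_lt with rfl | h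
  · exact knight_ediam_four_ne_top
  · rw [knight_ediam_two n h]
    exact ENat.natCast_ne_top _

/-- Strictness rests on the finiteness of the knight's diameter, which side 4 already has. -/
theorem pawn_add_two_lt {n : ℕ} (hn : 4 ≤ n) :
    ((n - 2 : ℕ) : ℕ∞) + returnTime n + 2 < ((n - 2 : ℕ) : ℕ∞) + (knightGraph n 2).ediam + 3 := by
  rw [returnTime_eq hn]
  lift (knightGraph n 2).ediam to ℕ using knight_ediam_ne_top hn with d
  norm_cast
  omega

theorem pawnEccent_le_three {n : ℕ} (x : Board n 3) :
    pawnEccent x ≤ ((n - 2 : ℕ) : ℕ∞) + returnTime n + 3 :=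
  iSup_le fun y => pawnDist_le (queen_edist_le x y)

theorem pawnDiam_three {n : ℕ} (hn : 5 ≤ n) :
    pawnDiam n 3 = ((n - 2 : ℕ) : ℕ∞) + (knightGraph n 2).ediam + 3 := by
  rw [← returnTime_eq (by omega)]
  refine le_antisymm (iSup_le pawnEccent_le_three) ?_
  have h := pawnDist_eq (n := n) (x := ![⟨0, by omega⟩, ⟨0, by omega⟩, ⟨0, by omega⟩])
    (y := ![⟨4, by omega⟩, ⟨2, by omega⟩, ⟨1, by omega⟩]) (by simp [disp]) (by simp [disp])
    (by simp [disp])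
  rw [← h]
  exact (le_iSup (fun y => pawnDist _ y) _).trans (le_iSup (fun x : Board n 3 => pawnEccent x) _)

theorem returnTime_ne_top {n : ℕ} (hn : n ≤ 3) : returnTime n ≠ ⊤ := by
  rw [returnTime, if_neg (by omega)]
  exact ne_top_of_le_ne_top (ENat.natCast_ne_top 2)
    (SimpleGraph.ediam_le_of_edist_le fun x y => queen_edist_le x y)

theorem pawnDiam_three_ne {n : ℕ} (h1 : 1 ≤ n) (h4 : n ≤ 4) :
    pawnDiam n 3 ≠ ((n - 2 : ℕ) : ℕ∞) + (knightGraph n 2).ediam + 3 := by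
  -- For `n = 1` the diameter is 0; for `n = 2, 3` the right side is infinite but the diameter is
  -- not; for `n = 4` all displacements are at most 3.
  obtain rfl | h | rfl : n = 1 ∨ (2 ≤ n ∧ n ≤ 3) ∨ n = 4 := by omega
  · have : pawnDiam 1 3 = 0 := by
      refine le_antisymm (iSup_le fun x => iSup_le fun y => ?_) zero_le
      rw [pawnDist, if_pos (Subsingleton.elim x y)]
    rw [this]
    exact (lt_of_lt_of_le (by norm_num) le_add_self : (0 : ℕ∞) < _ + 3).ne
  · rw [knight_ediam_eq_top n h.1 h.2, add_top, top_add]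
    refine ne_top_of_le_ne_top ?_ (iSup_le pawnEccent_le_three)
    simp [returnTime_ne_top h.2, ENat.add_eq_top]
  · refine (lt_of_le_of_lt (iSup_le fun x => iSup_le fun y => pawnDist_le
      (queen_edist_le_two_of_small fun j => ?_)) (pawn_add_two_lt le_rfl)).ne
    rw [disp, abs_le]
    omega

/-- On a board of side at least `8`, every coordinate can be changed by any amount up to `4`. -/
theorem exists_abs_sub_eq {n : ℕ} (hn : 8 ≤ n) (a : Fin n) (m : ℕ) (hm : m ≤ 4) :
    ∃ b : Fin n, |((b : ℕ) : ℤ) - ((a : ℕ) : ℤ)| = m := by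
  by_cases h : (a : ℕ) + m < n
  · exact ⟨⟨a + m, h⟩, by simp⟩
  · exact ⟨⟨a - m, by omega⟩, by rw [abs_eq (by omega)]; right; push_cast; omega⟩

theorem pawnRadius_three {n : ℕ} (hn : 8 ≤ n) :
    pawnRadius n 3 = ((n - 2 : ℕ) : ℕ∞) + (knightGraph n 2).ediam + 3 := by
  rw [← returnTime_eq (by omega)]
  refine le_antisymm ((iInf_le _ fun _ => ⟨0, by omega⟩).trans (pawnEccent_le_three _))
    (le_iInf fun x => ?_)
  obtain ⟨y0, h0⟩ := exists_abs_sub_eq hn (x 0) 4 (by norm_num)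
  obtain ⟨y1, h1⟩ := exists_abs_sub_eq hn (x 1) 2 (by norm_num)
  obtain ⟨y2, h2⟩ := exists_abs_sub_eq hn (x 2) 1 (by norm_num)
  rw [← pawnDist_eq (x := x) (y := ![y0, y1, y2]) h0 h1 h2]
  exact le_iSup (fun y => pawnDist x y) _

/-- When `n ≤ 7`, each coordinate of the central vertex is within 3 of every value, so the queen
needs at most two moves from there. -/
theorem pawnRadius_three_lt {n : ℕ} (h3 : 3 < n) (h8 : n < 8) :
    pawnRadius n 3 < ((n - 2 : ℕ) : ℕ∞) + (knightGraph n 2).ediam + 3 := by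
  refine lt_of_le_of_lt ((iInf_le _ fun _ => ⟨n / 2, by omega⟩).trans (iSup_le fun y =>
    pawnDist_le (queen_edist_le_two_of_small fun j => ?_))) (pawn_add_two_lt h3)
  rw [disp, abs_le]
  dsimp only
  omega

end LatticeChess

open LatticeChess in
theorem mainTheorem3 :
    -- for `n ≥ 5` the middle term of the pawn distance is `⌈2n/3⌉`
    (∀ n : ℕ, 5 ≤ n →
      (knightGraph n 2).ediam = (⌈(2 * n : ℚ) / 3⌉₊ : ℕ∞) ∧
      ∀ k : ℕ, 2 ≤ k → ∀ x y : Board n k, x ≠ y →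
        pawnDist x y = ((n - 2 : ℕ) : ℕ∞) + (⌈(2 * n : ℚ) / 3⌉₊ : ℕ∞) +
          min ((queenGraph n k).edist x y) ((knightGraph n k).edist x y)) ∧
    -- the diameter
    (∀ n : ℕ, 1 ≤ n →
      (pawnDiam n 3 = ((n - 2 : ℕ) : ℕ∞) + (knightGraph n 2).ediam + 3 ↔ 5 ≤ n)) ∧
    (∀ n : ℕ, 5 ≤ n →
      pawnDiam n 3 = ((n - 2 : ℕ) : ℕ∞) + (⌈(2 * n : ℚ) / 3⌉₊ : ℕ∞) + 3) ∧
    -- the radius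
    (∀ n : ℕ, 8 ≤ n →
      pawnRadius n 3 = ((n - 2 : ℕ) : ℕ∞) + (knightGraph n 2).ediam + 3) ∧
    (∀ n : ℕ, 3 < n → n < 8 →
      pawnRadius n 3 < ((n - 2 : ℕ) : ℕ∞) + (knightGraph n 2).ediam + 3) := by
  refine ⟨fun n hn => ?_, fun n hn => ?_, fun n hn => ?_, fun n hn => pawnRadius_three hn,
    fun n h3 h8 => pawnRadius_three_lt h3 h8⟩
  · have h := knight_ediam_two n hn
    rw [← natCeil_two_mul_div_three] at h
    refine ⟨h, fun k _ x y hxy => ?_⟩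
    rw [pawnDist, if_neg hxy, returnTime_eq (by omega), h]
  · refine ⟨fun h => ?_, pawnDiam_three⟩
    by_contra h5
    exact pawnDiam_three_ne hn (by omega) h
  · rw [pawnDiam_three hn, knight_ediam_two n hn, natCeil_two_mul_div_three]
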